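/- Let $M$ be a compact connected $n$-dimensional smooth Riemannian manifold and let $f\colon M\to\mathbb{R}^N$ be a smooth isometric immersion with second fundamental form $\alpha$, shape operators $A_\xi$ (defined by $\langle A_\xi X,Y\rangle=\langle\alpha(X,Y),\xi\rangle$) and normal spaces $T_x^\perp M$. Assume that $f$ is isoparametric: its normal bundle is flat and, for every parallel normal vector field $\xi$ along any curve in $M$, the principal curvatures with respect to $\xi$ (the eigenvalues of $A_\xi$) are constant with constant multiplicities. Let $p\in M$. The principal normals of $f$ at $p$ are the vectors $\eta\in T_p^\perp M$ for which $$E_\eta(p)=\{X\in T_pM:\ \alpha(X,Y)=\langle X,Y\rangle\,\eta\ \text{ for all } Y\in T_pM\}$$ is nonzero. The focal hyperplanes at $p$ are the affine hyperplanes $f(p)+\{v\in T_p^\perp M:\ \langle\eta,v\rangle=1\}$ of the affine normal space $f(p)+T_p^\perp M$, for the nonzero principal normals $\eta$ at $p$. The Weyl group $W(p)$ of $f$ at $p$ is the group of isometries of $f(p)+T_p^\perp M$ generated by the orthogonal reflections in the focal hyperplanes at $p$. Let $0\neq\xi\in T_p^\perp M$. Suppose that $W(p)$ leaves invariant an affine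 hyperplane $\mathcal{H}$ of $f(p)+T_p^\perp M$ which is orthogonal to $\xi$ and is not itself one of the focal hyperplanes at $p$. Then $f(M)$ is contained in the affine hyperplane of $\mathbb{R}^N$ through $f(p)$ orthogonal to $\xi$. -/

import Mathlib

open scoped Manifold ContDiff Bundle

noncomputable section

namespace Isoparametric

section Immersion

variable {n N : ℕ} {M : Type*} [TopologicalSpace M] [ChartedSpace (EuclideanSpace ℝ (Fin n)) M]

/-- The differential `f_* : T_x M → ℝ^N`. -/
def differential (f : M → EuclideanSpace ℝ (Fin N)) (x : M) :
    TangentSpace (𝓡 n) x →L[ℝ] EuclideanSpace ℝ (Fin N) :=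
  mfderiv (𝓡 n) 𝓘(ℝ, EuclideanSpace ℝ (Fin N)) f x

/-- The normal space `T_x^⊥ M = (f_* T_x M)^⊥` of `f` at `x`. -/
def normalSpace (f : M → EuclideanSpace ℝ (Fin N)) (x : M) :
    Submodule ℝ (EuclideanSpace ℝ (Fin N)) :=
  (LinearMap.range (differential (n := n) f x).toLinearMap)ᗮ

/-- The orthogonal projection of `ℝ^N` onto the normal space `T_x^⊥ M`. -/
def normalPart (f : M → EuclideanSpace ℝ (Fin N)) (x : M) :
    EuclideanSpace ℝ (Fin N) →L[ℝ] EuclideanSpace ℝ (Fin N) :=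
  (normalSpace (n := n) f x).starProjection

/-- The map `f` read in the preferred chart at `x`. -/
def inChart (f : M → EuclideanSpace ℝ (Fin N)) (x : M) :
    EuclideanSpace ℝ (Fin n) → EuclideanSpace ℝ (Fin N) :=
  f ∘ (extChartAt (𝓡 n) x).symm

/-- The second fundamental form `α_x(X, Y)`: the normal part of the second derivative of `f`.
Tangent vectors at `x` are by definition coordinate vectors in the preferred chart at `x`; the
normal part of the second derivative does not depend on the chart. -/
def secondFundamentalForm (f : M → EuclideanSpace ℝ (Fin N)) (x : M)
    (X Y : TangentSpace (𝓡 n) x) : EuclideanSpace ℝ (Fin N) :=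
  normalPart (n := n) f x (fderiv ℝ (fderiv ℝ (inChart (n := n) f x)) (extChartAt (𝓡 n) x x) X Y)

/-- The normal covariant derivative `∇^⊥_v ζ`, in the chart at `x`, of a field `ζ` along that chart
in the direction of the coordinate vector field with constant components `v`. -/
def normalCovDeriv (f : M → EuclideanSpace ℝ (Fin N)) (x : M) (v : EuclideanSpace ℝ (Fin n))
    (ζ : EuclideanSpace ℝ (Fin n) → EuclideanSpace ℝ (Fin N)) :
    EuclideanSpace ℝ (Fin n) → EuclideanSpace ℝ (Fin N) :=
  fun y => normalPart (n := n) f ((extChartAt (𝓡 n) x).symm y) (fderiv ℝ ζ y v)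

/-- The normal bundle is flat: the curvature tensor
`R^⊥(v, w)ζ = ∇^⊥_v ∇^⊥_w ζ - ∇^⊥_w ∇^⊥_v ζ - ∇^⊥_[v, w] ζ` of the normal connection vanishes at
every point `x`. It is evaluated on coordinate vector fields `v, w` of the chart at `x`, whose
bracket is zero, and on smooth normal fields `ζ` over the domain of that chart. -/
def HasFlatNormalBundle (f : M → EuclideanSpace ℝ (Fin N)) : Prop :=
  ∀ (x : M) (v w : EuclideanSpace ℝ (Fin n))
    (ζ : EuclideanSpace ℝ (Fin n) → EuclideanSpace ℝ (Fin N)),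
    ContDiffOn ℝ ∞ ζ (extChartAt (𝓡 n) x).target →
    (∀ y ∈ (extChartAt (𝓡 n) x).target,
      ζ y ∈ normalSpace (n := n) f ((extChartAt (𝓡 n) x).symm y)) →
    normalCovDeriv f x v (normalCovDeriv f x w ζ) (extChartAt (𝓡 n) x x) -
      normalCovDeriv f x w (normalCovDeriv f x v ζ) (extChartAt (𝓡 n) x x) = 0

/-- `ξ` is a normal vector field along the curve `γ : [a, b] → M`, parallel in the normal
connection: `ξ(t)` is normal and the normal part of `ξ'(t)` vanishes. (Smoothness of `ξ` follows
when `γ` is smooth.) -/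
def IsParallelAlong (f : M → EuclideanSpace ℝ (Fin N)) (a b : ℝ) (γ : ℝ → M)
    (ξ : ℝ → EuclideanSpace ℝ (Fin N)) : Prop :=
  ∀ t ∈ Set.Icc a b, ξ t ∈ normalSpace (n := n) f (γ t) ∧
    ∃ ξ', HasDerivWithinAt ξ ξ' (Set.Icc a b) t ∧ normalPart (n := n) f (γ t) ξ' = 0

end Immersion

section Riemannian

variable {n N : ℕ} {M : Type*} [TopologicalSpace M] [ChartedSpace (EuclideanSpace ℝ (Fin n)) M]
  [IsManifold (𝓡 n) ∞ M] [Bundle.RiemannianBundle (fun x : M => TangentSpace (𝓡 n) x)]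

/-- `f` is a smooth isometric immersion of the Riemannian manifold `M` into `ℝ^N`. -/
structure IsIsometricImmersion (f : M → EuclideanSpace ℝ (Fin N)) : Prop where
  contMDiff : ContMDiff (𝓡 n) 𝓘(ℝ, EuclideanSpace ℝ (Fin N)) ∞ f
  inner_mfderiv : ∀ (x : M) (X Y : TangentSpace (𝓡 n) x),
    inner ℝ (differential f x X) (differential f x Y) = inner ℝ X Y

/-- The space of `X ∈ T_x M` with `⟨α(X, Y), ξ⟩ = c ⟨X, Y⟩` for all `Y`. Since the shape operator
`A_ξ` is defined by `⟨A_ξ X, Y⟩ = ⟨α(X, Y), ξ⟩`, this is the eigenspace of `A_ξ` for `c`; so `c` is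
a principal curvature with respect to `ξ` when this space is nonzero, and its dimension is the
multiplicity of `c`. -/
def principalCurvatureSpace (f : M → EuclideanSpace ℝ (Fin N)) (x : M)
    (ξ : EuclideanSpace ℝ (Fin N)) (c : ℝ) : Submodule ℝ (TangentSpace (𝓡 n) x) where
  carrier := {X | ∀ Y : TangentSpace (𝓡 n) x,
    inner ℝ (secondFundamentalForm f x X Y) ξ = c * inner ℝ X Y}
  zero_mem' := by
    intro Y
    have h : secondFundamentalForm f x 0 Y = 0 := by
      unfold secondFundamentalForm
      erw [map_zero, zero_apply, map_zero]
    rw [h, inner_zero_left, inner_zero_left, mul_zero]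
  add_mem' := by
    intro X X' hX hX' Y
    have h : secondFundamentalForm f x (X + X') Y =
        secondFundamentalForm f x X Y + secondFundamentalForm f x X' Y := by
      unfold secondFundamentalForm
      erw [map_add, add_apply, map_add]
    rw [h, inner_add_left, inner_add_left, hX Y, hX' Y, mul_add]
  smul_mem' := by
    intro r X hX Y
    have h : secondFundamentalForm f x (r • X) Y = r • secondFundamentalForm f x X Y := by
      unfold secondFundamentalForm
      erw [map_smul, smul_apply, map_smul]
    rw [h, real_inner_smul_left, real_inner_smul_left, hX Y]
    ring

/-- `f` is an isoparametric isometric immersion: its normal bundle is flat and, for every parallel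
normal vector field along a smooth curve in `M`, the principal curvatures with respect to it are
constant, with constant multiplicities. -/
structure IsIsoparametric (f : M → EuclideanSpace ℝ (Fin N)) : Prop where
  isometricImmersion : IsIsometricImmersion (n := n) f
  flat : HasFlatNormalBundle (n := n) f
  constant : ∀ (a b : ℝ) (γ : ℝ → M) (ξ : ℝ → EuclideanSpace ℝ (Fin N)),
    ContMDiffOn 𝓘(ℝ, ℝ) (𝓡 n) ∞ γ (Set.Icc a b) → IsParallelAlong (n := n) f a b γ ξ →
    ∀ s ∈ Set.Icc a b, ∀ t ∈ Set.Icc a b, ∀ c : ℝ,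
      Module.finrank ℝ (principalCurvatureSpace (n := n) f (γ s) (ξ s) c) =
        Module.finrank ℝ (principalCurvatureSpace (n := n) f (γ t) (ξ t) c)

/-- The principal normals of `f` at `x`: the normal vectors `η` for which
`E_η(x) = {X | α(X, Y) = ⟨X, Y⟩ η for all Y}` is nontrivial. -/
def principalNormals (f : M → EuclideanSpace ℝ (Fin N)) (x : M) :
    Set (normalSpace (n := n) f x) :=
  {η | ∃ X : TangentSpace (𝓡 n) x, X ≠ 0 ∧ ∀ Y : TangentSpace (𝓡 n) x,
    secondFundamentalForm f x X Y = (inner ℝ X Y : ℝ) • (η : EuclideanSpace ℝ (Fin N))}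

end Riemannian

/-- The affine hyperplane `⟨η, v⟩ = 1` (empty for `η = 0`). -/
def focalHyperplane {V : Type*} [NormedAddCommGroup V] [InnerProductSpace ℝ V] (η : V) :
    AffineSubspace ℝ V where
  carrier := {v | inner ℝ η v = (1 : ℝ)}
  smul_vsub_vadd_mem' := by
    intro c p₁ p₂ p₃ h₁ h₂ h₃
    simp only [Set.mem_ofPred_eq] at h₁ h₂ h₃ ⊢
    simp [inner_add_right, inner_sub_right, real_inner_smul_right, h₁, h₂, h₃]

/-- The orthogonal reflection of `V` in the affine hyperplane `⟨η, v⟩ = 1`, for `η ≠ 0`. -/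
def focalReflection {V : Type*} [NormedAddCommGroup V] [InnerProductSpace ℝ V]
    [FiniteDimensional ℝ V] (η : V) (h : η ≠ 0) : V ≃ᵃⁱ[ℝ] V :=
  haveI : Nonempty (focalHyperplane η) :=
    ⟨⟨(inner ℝ η η : ℝ)⁻¹ • η, by
      change inner ℝ η ((inner ℝ η η : ℝ)⁻¹ • η) = (1 : ℝ)
      rw [real_inner_smul_right, inv_mul_cancel₀ (inner_self_ne_zero.2 h)]⟩⟩
  EuclideanGeometry.reflection (focalHyperplane η)

/-- The Weyl group of `f` at `p`, generated by the reflections in the focal hyperplanes of the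
principal normals at `p`. It acts on the affine normal space `f(p) + T_p^⊥ M`, which is identified
with `T_p^⊥ M` by the translation `v ↦ f(p) + v`. -/
def weylGroup {n N : ℕ} {M : Type*} [TopologicalSpace M]
    [ChartedSpace (EuclideanSpace ℝ (Fin n)) M] [IsManifold (𝓡 n) ∞ M]
    [Bundle.RiemannianBundle (fun x : M => TangentSpace (𝓡 n) x)]
    (f : M → EuclideanSpace ℝ (Fin N)) (p : M) :
    Subgroup (normalSpace (n := n) f p ≃ᵃⁱ[ℝ] normalSpace (n := n) f p) :=
  Subgroup.closure {g | ∃ η ∈ principalNormals f p, ∃ h : η ≠ 0, g = focalReflection η h}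

end Isoparametric

end

/-!
The vector `ξ` turns out to be orthogonal to all principal normals at `p`. Such a vector is constant
under parallel transport, and so confines the immersion to a hyperplane.

*Orthogonality at `p`.* The linear part of the reflection in a focal hyperplane `⟨η, v⟩ = 1`
preserves the direction `ξᗮ` of `H`, so `η` is either orthogonal or proportional to `ξ`. In the
second case `H` is parallel to the focal hyperplane, and a parallel hyperplane is invariant only if
the two coincide, which is excluded. So `ξ` is orthogonal to every principal normal at `p`
(`inner_eq_zero_of_image_focalReflection_eq`).

*Vanishing shape operator at `p`.* Let `P` be the orthogonal projection onto the normal spaces, read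
in a chart; it is smooth (`contDiffOn_starProjection_orthogonal_range`). On normal vectors `ζ` at
`p` the derivative `∂_v P ζ` is tangent and equals `-A_ζ v` (the Weingarten formula
`IsIsometricImmersion.inner_fderiv_normalPart`). Evaluating the normal curvature on the sections
`P ζ` shows that flatness means `⟨A_ζ₀ w, A_ζ₁ v⟩ = ⟨A_ζ₀ v, A_ζ₁ w⟩` (the Ricci equation
`inner_deriv_projection_comm`), that is, the shape operators commute. Their joint eigenspaces are
the spaces `E_η` of the principal normals `η`, and these span the tangent space; as `⟨η, ξ⟩ = 0`
for all of them, `A_ξ = 0` (`IsIsometricImmersion.inner_secondFundamentalForm_eq_zero`).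

*Propagation.* Transport `ξ` parallelly along a curve. Since principal curvatures of parallel
fields are constant with constant multiplicities, the shape operators of the transported field
vanish, so its tangential derivative vanishes as well: the field is the constant `ξ`. Hence `ξ`
remains normal along the curve and `⟨f, ξ⟩` is constant
(`IsIsoparametric.mem_hyperplaneContactSet_of_segment`). Parallel transport is only needed along
short segments in charts, where it solves the linear equation `ξ' = P' ξ`
(`exists_parallel_section`); connectedness of `M` does the rest.
-/

namespace Isoparametric

/-! ### Smooth dependence of normal projections -/

section Projection

variable {E F V : Type*} [NormedAddCommGroup E] [NormedSpace ℝ E]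
  [NormedAddCommGroup F] [InnerProductSpace ℝ F] [FiniteDimensional ℝ F]
  [NormedAddCommGroup V] [InnerProductSpace ℝ V] [FiniteDimensional ℝ V]

theorem isInvertible_adjoint_comp_self {J : V →L[ℝ] F} (hJ : Function.Injective J) :
    (J.adjoint ∘L J).IsInvertible := by
  have hinj : Function.Injective (J.adjoint ∘L J) := by
    refine (injective_iff_map_eq_zero _).2 fun v hv => ?_
    have h : inner ℝ (J v) (J v) = (0 : ℝ) := by
      rw [← ContinuousLinearMap.adjoint_inner_left]
      have : J.adjoint (J v) = 0 := hv
      rw [this, inner_zero_left]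
    exact hJ (by rw [inner_self_eq_zero.1 h, map_zero])
  exact ⟨(LinearEquiv.ofInjectiveEndo (J.adjoint ∘L J).toLinearMap hinj).toContinuousLinearEquiv,
    by ext v; rfl⟩

/-- The projection onto the complement of the range of `J` is `1 - J (J† J)⁻¹ J†`. -/
theorem starProjection_orthogonal_range_eq {J : V →L[ℝ] F} (hJ : Function.Injective J) :
    ((LinearMap.range J.toLinearMap)ᗮ).starProjection =
      ContinuousLinearMap.id ℝ F - J ∘L (J.adjoint ∘L J).inverse ∘L J.adjoint := by
  ext1 v
  apply Submodule.eq_starProjection_of_mem_of_inner_eq_zero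
  · rw [Submodule.mem_orthogonal]
    rintro _ ⟨w, rfl⟩
    have h : J.adjoint (J ((J.adjoint ∘L J).inverse (J.adjoint v))) = J.adjoint v :=
      (isInvertible_adjoint_comp_self hJ).self_apply_inverse _
    change inner ℝ (J w) (v - J ((J.adjoint ∘L J).inverse (J.adjoint v))) = 0
    rw [← ContinuousLinearMap.adjoint_inner_right, map_sub, h, sub_self, inner_zero_right]
  · intro w hw
    have : v - (ContinuousLinearMap.id ℝ F - J ∘L (J.adjoint ∘L J).inverse ∘L J.adjoint) v =
        J ((J.adjoint ∘L J).inverse (J.adjoint v)) := by simp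
    rw [this]
    exact (Submodule.mem_orthogonal _ _).1 hw _ ⟨_, rfl⟩

/-- The orthogonal projection onto the orthogonal complement of the range of an injective linear
map depends smoothly on that map. -/
theorem contDiffOn_starProjection_orthogonal_range {m : WithTop ℕ∞} {s : Set E}
    {J : E → V →L[ℝ] F} (hJ : ContDiffOn ℝ m J s) (hinj : ∀ y ∈ s, Function.Injective (J y)) :
    ContDiffOn ℝ m (fun y => ((LinearMap.range (J y).toLinearMap)ᗮ).starProjection) s := by
  let A : (V →L[ℝ] F) →L[ℝ] (F →L[ℝ] V) :=
    LinearMap.toContinuousLinearMap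
      { toFun := fun T => T.adjoint
        map_add' := fun S T => map_add _ S T
        map_smul' := fun c T => by simp }
  have hA : ContDiffOn ℝ m (fun y => (J y).adjoint) s := A.contDiff.comp_contDiffOn hJ
  have hAJ : ContDiffOn ℝ m (fun y => (J y).adjoint ∘L J y) s := hA.clm_comp hJ
  have hI : ContDiffOn ℝ m (fun y => ((J y).adjoint ∘L J y).inverse) s := fun y hy =>
    (isInvertible_adjoint_comp_self (hinj y hy)).contDiffAt_map_inverse.comp_contDiffWithinAt
      (f := fun y => (J y).adjoint ∘L J y) y (hAJ y hy)
  exact (contDiffOn_const.sub (hJ.clm_comp (hI.clm_comp hA))).congr fun y hy =>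
    starProjection_orthogonal_range_eq (hinj y hy)

end Projection

/-! ### Derivatives of a family of projections and the Ricci equation -/

section Ricci

variable {E F : Type*} [NormedAddCommGroup E] [NormedSpace ℝ E]
  [NormedAddCommGroup F] [InnerProductSpace ℝ F]

/-- Differentiating `P² = P` gives `P ∂P P = 0`. -/
theorem apply_deriv_apply_eq_zero_of_idempotent {P : E → F →L[ℝ] F} {P' : E →L[ℝ] F →L[ℝ] F}
    {y : E} (hP : HasFDerivAt P P' y) (hPP : ∀ᶠ z in nhds y, ∀ u, P z (P z u) = P z u)
    (v : E) {ζ : F} (hζ : P y ζ = ζ) : P y (P' v ζ) = 0 := by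
  have h1 : HasFDerivAt (fun z => P z (P z ζ)) _ y :=
    hP.clm_apply (hP.clm_apply (hasFDerivAt_const ζ y))
  have h2 : HasFDerivAt (fun z => P z ζ) _ y := hP.clm_apply (hasFDerivAt_const ζ y)
  have h3 := h1.unique (h2.congr_of_eventuallyEq (hPP.mono fun z hz => hz ζ))
  have h4 := congrArg (fun T => T v) h3
  simp [hζ] at h4
  exact h4

/-- The product rule for `⟨P ζ, J X⟩ = 0`, along vectors of the base. -/
theorem inner_deriv_add_inner_deriv_eq_zero {F' : Type*} [NormedAddCommGroup F'] [NormedSpace ℝ F']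
    {P : E → F →L[ℝ] F} {P' : E →L[ℝ] F →L[ℝ] F} {J : E → F' →L[ℝ] F} {J' : E →L[ℝ] F' →L[ℝ] F}
    {y : E} (hP : HasFDerivAt P P' y) (hJ : HasFDerivAt J J' y) {ζ : F} {X : F'}
    (h : ∀ᶠ z in nhds y, inner ℝ (P z ζ) (J z X) = (0 : ℝ)) (v : E) :
    inner ℝ (P' v ζ) (J y X) + inner ℝ (P y ζ) (J' v X) = (0 : ℝ) := by
  have h1 : HasFDerivAt (fun z => (inner ℝ (P z ζ) (J z X) : ℝ)) _ y :=
    (hP.clm_apply (hasFDerivAt_const ζ y)).inner ℝ (hJ.clm_apply (hasFDerivAt_const X y))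
  have h3 := congrArg (fun T => T v)
    (h1.unique ((hasFDerivAt_const (0 : ℝ) y).congr_of_eventuallyEq h))
  simpa [add_comm] using h3

/-- The product rule for `⟨ξ, J X⟩ = 0`, along a curve `c`. -/
theorem inner_derivWithin_add_inner_deriv_eq_zero {F' : Type*} [NormedAddCommGroup F']
    [NormedSpace ℝ F'] {s : Set ℝ} {t : ℝ} (hs : UniqueDiffWithinAt ℝ s t) (ht : t ∈ s)
    {ξ : ℝ → F} {ξ' : F} (hξ : HasDerivWithinAt ξ ξ' s t)
    {c : ℝ → E} {c' : E} (hc : HasDerivWithinAt c c' s t)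
    {J : E → F' →L[ℝ] F} {J' : E →L[ℝ] F' →L[ℝ] F} (hJ : HasFDerivAt J J' (c t)) {X : F'}
    (h : ∀ᶠ r in nhdsWithin t s, inner ℝ (ξ r) (J (c r) X) = (0 : ℝ)) :
    inner ℝ ξ' (J (c t) X) + inner ℝ (ξ t) (J' c' X) = (0 : ℝ) := by
  have h1 : HasDerivWithinAt (fun r => (inner ℝ (ξ r) (J (c r) X) : ℝ))
      (inner ℝ (ξ t) (J' c' X + J (c t) 0) + inner ℝ ξ' (J (c t) X)) s t :=
    hξ.inner ℝ ((hJ.comp_hasDerivWithinAt t hc).clm_apply (hasDerivWithinAt_const t s X))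
  have h2 : HasDerivWithinAt (fun _ : ℝ => (0 : ℝ)) 0 s t := hasDerivWithinAt_const ..
  have h3 := hs.eq_deriv _ h1 (h2.congr_of_eventuallyEq_of_mem h ht)
  rwa [map_zero, add_zero, add_comm] at h3

/-- The Ricci equation for a family of orthogonal projections `P`: if the curvature of the
connection `P ∘ d` vanishes at `y` on the sections `P ζ`, then the bilinear form
`⟨∂_v P ζ₀, ∂_w P ζ₁⟩` is symmetric in `v` and `w`. -/
theorem inner_deriv_projection_comm {P : E → F →L[ℝ] F} {y : E}
    (hP : ContDiffAt ℝ 2 P y)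
    (hsymm : ∀ᶠ z in nhds y, ∀ u u', inner ℝ (P z u) u' = (inner ℝ u (P z u') : ℝ))
    (v w : E) (ζ₀ ζ₁ : F) (h₁ : P y ζ₁ = ζ₁)
    (hflat : P y (fderiv ℝ (fun z => P z (fderiv ℝ (fun z => P z ζ₀) z w)) y v) -
      P y (fderiv ℝ (fun z => P z (fderiv ℝ (fun z => P z ζ₀) z v)) y w) = 0) :
    inner ℝ (fderiv ℝ P y w ζ₀) (fderiv ℝ P y v ζ₁) =
      (inner ℝ (fderiv ℝ P y v ζ₀) (fderiv ℝ P y w ζ₁) : ℝ) := by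
  have hPd : HasFDerivAt P (fderiv ℝ P y) y := (hP.differentiableAt (by norm_num)).hasFDerivAt
  -- Derivatives of self-adjoint operators are self-adjoint.
  have hsD : ∀ v u u', inner ℝ (fderiv ℝ P y v u) u' = (inner ℝ u (fderiv ℝ P y v u') : ℝ) := by
    intro v u u'
    have h1 : HasFDerivAt (fun z => (inner ℝ (P z u) u' : ℝ)) _ y :=
      (hPd.clm_apply (hasFDerivAt_const u y)).inner ℝ (hasFDerivAt_const u' y)
    have h2 : HasFDerivAt (fun z => (inner ℝ u (P z u') : ℝ)) _ y :=
      (hasFDerivAt_const u y).inner ℝ (hPd.clm_apply (hasFDerivAt_const u' y))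
    have h3 := congrArg (fun T => T v)
      (h1.unique (h2.congr_of_eventuallyEq (hsymm.mono fun z hz => hz u u')))
    simpa using h3
  set ζ : E → F := fun z => P z ζ₀ with hζ
  have hζc : ContDiffAt ℝ 2 ζ y := hP.clm_apply contDiffAt_const
  have hζ1 : ∀ v, fderiv ℝ ζ y v = fderiv ℝ P y v ζ₀ := by
    intro v
    have := (hPd.clm_apply (hasFDerivAt_const ζ₀ y)).fderiv
    rw [hζ, this]; simp
  have hζd : DifferentiableAt ℝ (fderiv ℝ ζ) y :=
    (hζc.fderiv_right (m := 1) (by norm_num)).differentiableAt (by norm_num)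
  have hsnd : ∀ v w, fderiv ℝ (fun z => P z (fderiv ℝ ζ z w)) y v =
      fderiv ℝ P y v (fderiv ℝ P y w ζ₀) + P y (fderiv ℝ (fderiv ℝ ζ) y v w) := by
    intro v w
    have h1 : HasFDerivAt (fun z => fderiv ℝ ζ z w) _ y :=
      hζd.hasFDerivAt.clm_apply (hasFDerivAt_const w y)
    rw [(hPd.clm_apply h1).fderiv]
    simp [hζ1, add_comm]
  -- Paired with `ζ₁`, the second derivatives of `ζ` cancel by symmetry.
  have hs := (hζc.isSymmSndFDerivAt (by simp)).eq v w
  rw [hsnd, hsnd, sub_eq_zero] at hflat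
  have hPs := hsymm.self_of_nhds
  have h := congrArg (fun u => (inner ℝ u ζ₁ : ℝ)) hflat
  simp only [hPs, h₁, inner_add_left, hs] at h
  rw [add_left_inj] at h
  rw [← hsD v, h, hsD w]

end Ricci

/-! ### Simultaneous diagonalization by principal normals -/

section Diagonalization

variable {V G : Type*} [NormedAddCommGroup V] [InnerProductSpace ℝ V] [FiniteDimensional ℝ V]
  [NormedAddCommGroup G] [InnerProductSpace ℝ G] [FiniteDimensional ℝ G]

/-- If the shape operators `A ζ` of a symmetric bilinear map `β` commute, then `V` is the sum of
the eigenspaces of the principal normals of `β`; a vector orthogonal to all principal normals is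
therefore orthogonal to all values of `β`. -/
theorem inner_eq_zero_of_orthogonal_principalNormals (β : V → V → G)
    (hβ : ∀ X Y, β X Y = β Y X) (A : G → V →ₗ[ℝ] V)
    (hA : ∀ ζ X Y, inner ℝ (A ζ X) Y = (inner ℝ (β X Y) ζ : ℝ))
    (hcomm : ∀ ζ₀ ζ₁ X Y,
      (inner ℝ (A ζ₀ X) (A ζ₁ Y) : ℝ) = inner ℝ (A ζ₀ Y) (A ζ₁ X))
    (ξ : G)
    (hξ : ∀ η : G, (∃ X : V, X ≠ 0 ∧ ∀ Y, β X Y = (inner ℝ X Y : ℝ) • η) → inner ℝ η ξ = (0 : ℝ))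
    (X Y : V) : inner ℝ (β X Y) ξ = (0 : ℝ) := by
  have hsymm : ∀ ζ, (A ζ).IsSymmetric := fun ζ X Y => by
    rw [hA, hβ, ← hA, real_inner_comm]
  have hC : ∀ ζ₀ ζ₁, Commute (A ζ₀) (A ζ₁) := by
    intro ζ₀ ζ₁
    refine LinearMap.ext fun X => ext_inner_right ℝ fun Y => ?_
    change inner ℝ (A ζ₀ (A ζ₁ X)) Y = (inner ℝ (A ζ₁ (A ζ₀ X)) Y : ℝ)
    rw [hsymm ζ₀, hsymm ζ₁ (A ζ₀ X), hcomm]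
    exact real_inner_comm _ _
  let b := stdOrthonormalBasis ℝ G
  have htop := LinearMap.IsSymmetric.iSup_iInf_eq_top_of_commute (T := fun i => A (b i))
    (fun i => hsymm _) (fun i j _ => hC _ _)
  have hX : X ∈ (⨆ χ : Fin (Module.finrank ℝ G) → ℝ,
      ⨅ i, Module.End.eigenspace (A (b i)) (χ i)) := by rw [htop]; trivial
  suffices h : (⨆ χ : Fin (Module.finrank ℝ G) → ℝ,
      ⨅ i, Module.End.eigenspace (A (b i)) (χ i)) ≤ LinearMap.ker (A ξ) by
    rw [← hA, LinearMap.mem_ker.1 (h hX), inner_zero_left]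
  refine iSup_le fun χ Z hZ => ?_
  rw [Submodule.mem_iInf] at hZ
  by_cases hZ0 : Z = 0
  · rw [hZ0]; exact zero_mem _
  -- A joint eigenvector with eigenvalues `χ i` along the basis has principal normal `∑ χ i b i`.
  have hη : ∀ Y, β Z Y = (inner ℝ Z Y : ℝ) • ∑ i, χ i • b i := by
    intro Y
    rw [← b.sum_repr (β Z Y), Finset.smul_sum]
    refine Finset.sum_congr rfl fun i _ => ?_
    rw [b.repr_apply_apply, real_inner_comm, ← hA, Module.End.mem_eigenspace_iff.1 (hZ i),
      real_inner_smul_left, smul_smul, mul_comm]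
  have h0 := hξ _ ⟨Z, hZ0, hη⟩
  refine LinearMap.mem_ker.2 (ext_inner_right ℝ fun Y => ?_)
  rw [hA, hη, real_inner_smul_left, h0, mul_zero, inner_zero_left]

end Diagonalization

/-! ### Parallel transport for a curve of projections -/

section ParallelTransport

variable {F : Type*} [NormedAddCommGroup F] [NormedSpace ℝ F] [CompleteSpace F]

open Set

/-- A linear differential equation `ξ' = B ξ` on `[0, 1]` with `‖B‖ ≤ 1 / 2` is solvable. -/
theorem exists_hasDerivWithinAt_linear {B : ℝ → F →L[ℝ] F} (hB : ContinuousOn B (Icc 0 1))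
    (hB' : ∀ t ∈ Icc (0 : ℝ) 1, ‖B t‖ ≤ 1 / 2) (ξ₀ : F) :
    ∃ ξ : ℝ → F, ξ 0 = ξ₀ ∧ ∀ t ∈ Icc (0 : ℝ) 1, HasDerivWithinAt ξ (B t (ξ t)) (Icc 0 1) t := by
  -- On the ball of radius `‖ξ₀‖` about `ξ₀` the field is at most `‖ξ₀‖`, so that no solution leaves
  -- the ball before time `1`.
  have h : IsPicardLindelof (fun t x => B t x) (tmin := 0) (tmax := 1)
      ⟨0, left_mem_Icc.2 zero_le_one⟩ ξ₀ ‖ξ₀‖₊ 0 ‖ξ₀‖₊ (1 / 2) := by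
    refine ⟨fun t ht => ?_, fun x _ => hB.clm_apply continuousOn_const, fun t ht x hx => ?_, ?_⟩
    · exact ((B t).lipschitz.weaken (by
        rw [← NNReal.coe_le_coe]; simpa using hB' t ht)).lipschitzOnWith
    · have h1 : ‖x‖ ≤ ‖ξ₀‖ + ‖ξ₀‖ := by
        have h2 : ‖x - ξ₀‖ ≤ ‖ξ₀‖ := by simpa [dist_eq_norm] using hx
        have h3 : x = ξ₀ + (x - ξ₀) := by abel
        calc ‖x‖ ≤ ‖ξ₀‖ + ‖x - ξ₀‖ := by conv_lhs => rw [h3]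
                                         exact norm_add_le _ _
          _ ≤ _ := by gcongr
      calc ‖B t x‖ ≤ ‖B t‖ * ‖x‖ := (B t).le_opNorm x
        _ ≤ 1 / 2 * (‖ξ₀‖ + ‖ξ₀‖) := by gcongr; exact hB' t ht
        _ = ‖ξ₀‖ := by ring
    · simp
  exact h.exists_eq_forall_mem_Icc_hasDerivWithinAt₀

/-- Parallel transport for a family of projections `P` with small derivative: a vector in the range
of `P 0` extends to a section of the ranges whose derivative lies in the kernels. The section solves
`ξ' = P' ξ`. -/
theorem exists_parallel_section {P B : ℝ → F →L[ℝ] F}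
    (hP : ∀ t ∈ Icc (0 : ℝ) 1, HasDerivWithinAt P (B t) (Icc 0 1) t)
    (hPP : ∀ t ∈ Icc (0 : ℝ) 1, ∀ u, P t (P t u) = P t u) (hPn : ∀ t ∈ Icc (0 : ℝ) 1, ‖P t‖ ≤ 1)
    (hB : ContinuousOn B (Icc 0 1))
    (hB' : ∀ t ∈ Icc (0 : ℝ) 1, ‖B t‖ ≤ 1 / 2) {ξ₀ : F} (hξ₀ : P 0 ξ₀ = ξ₀) :
    ∃ ξ : ℝ → F, ξ 0 = ξ₀ ∧ ∀ t ∈ Icc (0 : ℝ) 1, P t (ξ t) = ξ t ∧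
      ∃ ξ', HasDerivWithinAt ξ ξ' (Icc 0 1) t ∧ P t ξ' = 0 := by
  obtain ⟨ξ, h0, hξ⟩ := exists_hasDerivWithinAt_linear hB hB' ξ₀
  have hud : UniqueDiffOn ℝ (Icc (0 : ℝ) 1) := uniqueDiffOn_Icc zero_lt_one
  -- Differentiating `P² = P` gives `B P + P B = B`.
  have hBP : ∀ t ∈ Icc (0 : ℝ) 1, ∀ u, B t (P t u) + P t (B t u) = B t u := by
    intro t ht u
    have h1 : HasDerivWithinAt (fun s => P s (P s u)) (B t (P t u) + P t (B t u + P t 0))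
        (Icc 0 1) t :=
      (hP t ht).clm_apply ((hP t ht).clm_apply (hasDerivWithinAt_const t _ u))
    have h2 : HasDerivWithinAt (fun s => P s u) (B t u + P t 0) (Icc 0 1) t :=
      (hP t ht).clm_apply (hasDerivWithinAt_const t _ u)
    have h3 := (hud t ht).eq_deriv _ h1 (h2.congr (fun s hs => hPP s hs u) (hPP t ht u))
    simpa using h3
  -- The component `u = ξ - P ξ` in the kernels solves the linear equation `u' = -P B u`.
  have hu : ∀ t ∈ Icc (0 : ℝ) 1,
      HasDerivWithinAt (fun s => ξ s - P s (ξ s)) (-P t (B t (ξ t - P t (ξ t)))) (Icc 0 1) t := by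
    intro t ht
    have h1 := (hξ t ht).sub ((hP t ht).clm_apply (hξ t ht))
    convert! h1 using 1
    have h2 := hBP t ht (P t (ξ t))
    rw [hPP t ht] at h2
    have h3 : P t (B t (P t (ξ t))) = 0 := by simpa using h2
    rw [map_sub, map_sub, h3]
    abel
  have hker : ∀ t ∈ Icc (0 : ℝ) 1, ξ t - P t (ξ t) = 0 := by
    have h := norm_le_gronwallBound_of_norm_deriv_right_le (f := fun s => ξ s - P s (ξ s))
      (f' := fun t => -P t (B t (ξ t - P t (ξ t)))) (δ := 0) (K := 1 / 2) (ε := 0) (a := 0) (b := 1)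
      (fun t ht => (hu t ht).continuousWithinAt)
      (fun t ht => ((hu t ⟨ht.1, ht.2.le⟩).mono_of_mem_nhdsWithin
        (mem_nhdsWithin.2 ⟨Iio 1, isOpen_Iio, ht.2, fun s hs => ⟨ht.1.trans hs.2, hs.1.le⟩⟩)))
      (by simp [h0, hξ₀]) (fun t ht => by
        have ht' : t ∈ Icc (0 : ℝ) 1 := ⟨ht.1, ht.2.le⟩
        rw [norm_neg, add_zero]
        calc _ ≤ ‖P t‖ * ‖B t (ξ t - P t (ξ t))‖ := (P t).le_opNorm _
          _ ≤ 1 * (‖B t‖ * ‖ξ t - P t (ξ t)‖) := by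
            gcongr
            · exact hPn t ht'
            · exact (B t).le_opNorm _
          _ ≤ _ := by rw [one_mul]; gcongr; exact hB' t ht')
    intro t ht
    have := h t ht
    rw [gronwallBound_ε0_δ0] at this
    exact norm_le_zero_iff.1 this
  refine ⟨ξ, h0, fun t ht => ?_⟩
  have h1 : P t (ξ t) = ξ t := (sub_eq_zero.1 (hker t ht)).symm
  refine ⟨h1, _, hξ t ht, ?_⟩
  have h2 := hBP t ht (ξ t)
  rw [h1] at h2
  simpa using h2

end ParallelTransport

/-! ### A local bound for derivatives -/

section Bound

theorem exists_eventually_norm_fderiv_apply_le {E G : Type*} [NormedAddCommGroup E]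
    [NormedSpace ℝ E] [NormedAddCommGroup G] [NormedSpace ℝ G] {g : E → G} {y : E}
    (hg : ContinuousAt (fderiv ℝ g) y) :
    ∃ C : ℝ, 0 < C ∧ ∀ᶠ z in nhds y, ∀ v, ‖fderiv ℝ g z v‖ ≤ C * ‖v‖ := by
  refine ⟨‖fderiv ℝ g y‖ + 1, by positivity, ?_⟩
  filter_upwards [hg.norm.eventually (gt_mem_nhds (lt_add_one ‖fderiv ℝ g y‖))] with z hz v
  exact (fderiv ℝ g z).le_of_opNorm_le hz.le v

end Bound

/-! ### Hyperplanes invariant under focal reflections -/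

section Hyperplane

variable {V : Type*} [NormedAddCommGroup V] [InnerProductSpace ℝ V] [FiniteDimensional ℝ V]

theorem focalReflection_apply (η : V) (h : η ≠ 0) (v : V) :
    focalReflection η h v = v - (2 * (inner ℝ η v - 1) / inner ℝ η η) • η := by
  have hηη : inner ℝ η η ≠ (0 : ℝ) := inner_self_ne_zero.2 h
  set c : ℝ := (inner ℝ η v - 1) / inner ℝ η η with hc
  have hmem : v - c • η ∈ focalHyperplane η := by
    change inner ℝ η (v - c • η) = (1 : ℝ)
    rw [inner_sub_right, real_inner_smul_right, hc, div_mul_cancel₀ _ hηη, sub_sub_cancel]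
  have hperp : c • η ∈ (focalHyperplane η).directionᗮ := by
    refine Submodule.smul_mem _ _ ((Submodule.mem_orthogonal _ _).2 fun u hu => ?_)
    have h1 : u +ᵥ (v - c • η) ∈ focalHyperplane η :=
      AffineSubspace.vadd_mem_of_mem_direction hu hmem
    change inner ℝ η (u + (v - c • η)) = (1 : ℝ) at h1
    change inner ℝ η (v - c • η) = (1 : ℝ) at hmem
    rw [inner_add_right, hmem] at h1
    rw [real_inner_comm]
    linarith
  have : Nonempty (focalHyperplane η) := ⟨⟨_, hmem⟩⟩
  have key := EuclideanGeometry.reflection_orthogonal_vadd hmem hperp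
  rw [vadd_eq_add, vadd_eq_add, add_sub_cancel] at key
  refine Eq.trans key ?_
  rw [mul_div_assoc, ← hc, two_mul, add_smul]
  abel

/-- A hyperplane orthogonal to `ξ` and invariant under the reflection in the hyperplane
`⟨η, v⟩ = 1`, but different from it, is perpendicular to it. -/
theorem inner_eq_zero_of_image_focalReflection_eq {η ξ : V} (hη : η ≠ 0) (hξ : ξ ≠ 0)
    {H : AffineSubspace ℝ V} (hne : (H : Set V).Nonempty)
    (hdir : H.direction = (Submodule.span ℝ {ξ})ᗮ) (hH : H ≠ focalHyperplane η)
    (hinv : focalReflection η hη '' (H : Set V) = H) : inner ℝ η ξ = (0 : ℝ) := by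
  by_contra hc
  have hηη : inner ℝ η η ≠ (0 : ℝ) := inner_self_ne_zero.2 hη
  obtain ⟨v₀, hv₀⟩ := hne
  have hmem : ∀ v, v ∈ H ↔ inner ℝ ξ (v - v₀) = (0 : ℝ) := by
    intro v
    rw [← Submodule.mem_orthogonal_singleton_iff_inner_right, ← hdir,
      ← AffineSubspace.vsub_right_mem_direction_iff_mem (p := v₀) hv₀, vsub_eq_sub]
  -- A point of `H` is moved within `H` along `η`, which is not tangent to `H`; hence it is fixed.
  have hfix : ∀ v ∈ H, inner ℝ η v = (1 : ℝ) := by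
    intro v hv
    have h1 : focalReflection η hη v ∈ H := by
      have : focalReflection η hη v ∈ (H : Set V) := hinv ▸ Set.mem_image_of_mem _ hv
      exact this
    rw [hmem, focalReflection_apply] at h1
    rw [hmem] at hv
    have h2 : v - (2 * (inner ℝ η v - 1) / inner ℝ η η) • η - v₀ =
        (v - v₀) - (2 * (inner ℝ η v - 1) / inner ℝ η η) • η := by abel
    rw [h2, inner_sub_right, hv, real_inner_smul_right, real_inner_comm η ξ, zero_sub, neg_eq_zero,
      mul_eq_zero, or_iff_left hc, div_eq_zero_iff, or_iff_left hηη] at h1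
    linarith
  apply hH
  have hle : H ≤ focalHyperplane η := fun v hv => hfix v hv
  -- Both are hyperplanes: `η` is orthogonal to `ξᗮ`, so it is a multiple of `ξ`.
  have hηξ : ∀ u, inner ℝ ξ u = (0 : ℝ) → inner ℝ η u = (0 : ℝ) := by
    intro u hu
    have h1 := hfix (v₀ + u) ((hmem _).2 (by simpa using hu))
    have h2 := hfix v₀ hv₀
    rw [inner_add_right, h2] at h1
    linarith
  refine le_antisymm hle fun v hv => (hmem v).2 ?_
  have hv' : inner ℝ η v = (1 : ℝ) := hv
  have hξξ : inner ℝ ξ ξ ≠ (0 : ℝ) := inner_self_ne_zero.2 hξ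
  -- Decompose `v - v₀` into its component along `ξ` and a vector orthogonal to `ξ`.
  have h1 := hηξ ((v - v₀) - (inner ℝ ξ (v - v₀) / inner ℝ ξ ξ) • ξ) (by
    rw [inner_sub_right, real_inner_smul_right]; field_simp; ring)
  rw [inner_sub_right, inner_sub_right, hv', hfix v₀ hv₀, real_inner_smul_right, sub_self,
    zero_sub, neg_eq_zero, mul_eq_zero, or_iff_left hc, div_eq_zero_iff, or_iff_left hξξ] at h1
  exact h1

end Hyperplane

/-! ### The normal bundle in a chart -/

section Chart

variable {n N : ℕ} {M : Type*} [TopologicalSpace M] [ChartedSpace (EuclideanSpace ℝ (Fin n)) M]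

theorem mem_normalSpace_iff {f : M → EuclideanSpace ℝ (Fin N)} {x : M}
    {ζ : EuclideanSpace ℝ (Fin N)} :
    ζ ∈ normalSpace (n := n) f x ↔
      ∀ X : TangentSpace (𝓡 n) x, inner ℝ (differential f x X) ζ = (0 : ℝ) := by
  rw [normalSpace, Submodule.mem_orthogonal]
  exact ⟨fun h X => h _ ⟨X, rfl⟩, by rintro h _ ⟨X, rfl⟩; exact h X⟩

theorem normalPart_eq_self_iff {f : M → EuclideanSpace ℝ (Fin N)} {x : M}
    {ζ : EuclideanSpace ℝ (Fin N)} :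
    normalPart (n := n) f x ζ = ζ ↔ ζ ∈ normalSpace (n := n) f x :=
  Submodule.starProjection_eq_self_iff

theorem normalPart_mem (f : M → EuclideanSpace ℝ (Fin N)) (x : M) (u : EuclideanSpace ℝ (Fin N)) :
    normalPart (n := n) f x u ∈ normalSpace (n := n) f x :=
  Submodule.starProjection_apply_mem _ _

theorem inner_normalPart_left (f : M → EuclideanSpace ℝ (Fin N)) (x : M)
    (u w : EuclideanSpace ℝ (Fin N)) :
    inner ℝ (normalPart (n := n) f x u) w = (inner ℝ u (normalPart (n := n) f x w) : ℝ) :=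
  Submodule.starProjection_isSymmetric _ u w

theorem inner_secondFundamentalForm {f : M → EuclideanSpace ℝ (Fin N)} {x : M}
    {ζ : EuclideanSpace ℝ (Fin N)} (hζ : ζ ∈ normalSpace (n := n) f x)
    (X Y : TangentSpace (𝓡 n) x) :
    inner ℝ (secondFundamentalForm f x X Y) ζ =
      (inner ℝ (fderiv ℝ (fderiv ℝ (inChart (n := n) f x)) (extChartAt (𝓡 n) x x) X Y) ζ : ℝ) := by
  rw [secondFundamentalForm, inner_normalPart_left, normalPart_eq_self_iff.2 hζ]

theorem differential_apply_eq_fderiv {f : M → EuclideanSpace ℝ (Fin N)}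
    (hf : ContMDiff (𝓡 n) 𝓘(ℝ, EuclideanSpace ℝ (Fin N)) ∞ f) (x : M)
    (X : TangentSpace (𝓡 n) x) :
    differential f x X = fderiv ℝ (inChart (n := n) f x) (extChartAt (𝓡 n) x x) X := by
  have h : MDifferentiableAt (𝓡 n) 𝓘(ℝ, EuclideanSpace ℝ (Fin N)) f x :=
    hf.mdifferentiableAt (by simp)
  have h2 := h.mfderiv
  rw [ModelWithCorners.range_eq_univ, fderivWithin_univ] at h2
  exact congrArg (fun T => T X) h2

variable [IsManifold (𝓡 n) ∞ M]

theorem contDiffOn_inChart {f : M → EuclideanSpace ℝ (Fin N)}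
    (hf : ContMDiff (𝓡 n) 𝓘(ℝ, EuclideanSpace ℝ (Fin N)) ∞ f) (x : M) :
    ContDiffOn ℝ ∞ (inChart (n := n) f x) (extChartAt (𝓡 n) x).target :=
  (hf.comp_contMDiffOn (contMDiffOn_extChartAt_symm x)).contDiffOn

/-- At points of the chart domain at `x`, the derivative of `f` read in that chart is the
differential of `f`, up to a change of coordinates: the differential at a point refers to the
preferred chart at that point. -/
theorem exists_fderiv_inChart_eq {f : M → EuclideanSpace ℝ (Fin N)}
    (hf : ContMDiff (𝓡 n) 𝓘(ℝ, EuclideanSpace ℝ (Fin N)) ∞ f) {x : M}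
    {y : EuclideanSpace ℝ (Fin n)} (hy : y ∈ (extChartAt (𝓡 n) x).target) :
    ∃ L : EuclideanSpace ℝ (Fin n) → TangentSpace (𝓡 n) ((extChartAt (𝓡 n) x).symm y),
      Function.Bijective L ∧
      ∀ v, fderiv ℝ (inChart (n := n) f x) y v =
        differential f ((extChartAt (𝓡 n) x).symm y) (L v) := by
  have : IsManifold (𝓡 n) 1 M := IsManifold.of_le (n := ∞) (by norm_num)
  have hinv := isInvertible_mfderivWithin_extChartAt_symm hy
  have hs : MDifferentiableAt 𝓘(ℝ, EuclideanSpace ℝ (Fin n)) (𝓡 n) (extChartAt (𝓡 n) x).symm y :=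
    ((contMDiffOn_extChartAt_symm (n := ∞) x).contMDiffAt
      ((isOpen_extChartAt_target x).mem_nhds hy)).mdifferentiableAt (by simp)
  have hff : MDifferentiableAt (𝓡 n) 𝓘(ℝ, EuclideanSpace ℝ (Fin N)) f
      ((extChartAt (𝓡 n) x).symm y) := hf.mdifferentiableAt (by simp)
  have hc := mfderiv_comp y hff hs
  rw [ModelWithCorners.range_eq_univ, mfderivWithin_univ] at hinv
  refine ⟨mfderiv 𝓘(ℝ, EuclideanSpace ℝ (Fin n)) (𝓡 n) (extChartAt (𝓡 n) x).symm y,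
    hinv.bijective, fun v => ?_⟩
  rw [← mfderiv_eq_fderiv]
  exact congrArg (fun T => T v) hc

theorem mem_normalSpace_symm_iff {f : M → EuclideanSpace ℝ (Fin N)}
    (hf : ContMDiff (𝓡 n) 𝓘(ℝ, EuclideanSpace ℝ (Fin N)) ∞ f) {x : M}
    {y : EuclideanSpace ℝ (Fin n)} (hy : y ∈ (extChartAt (𝓡 n) x).target)
    {ζ : EuclideanSpace ℝ (Fin N)} :
    ζ ∈ normalSpace (n := n) f ((extChartAt (𝓡 n) x).symm y) ↔
      ∀ v, inner ℝ (fderiv ℝ (inChart (n := n) f x) y v) ζ = (0 : ℝ) := by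
  obtain ⟨L, hL, h⟩ := exists_fderiv_inChart_eq hf hy
  rw [mem_normalSpace_iff]
  refine ⟨fun H v => by rw [h]; exact H _, fun H X => ?_⟩
  obtain ⟨v, rfl⟩ := hL.2 X
  rw [← h]
  exact H v

theorem normalSpace_symm_eq {f : M → EuclideanSpace ℝ (Fin N)}
    (hf : ContMDiff (𝓡 n) 𝓘(ℝ, EuclideanSpace ℝ (Fin N)) ∞ f) {x : M}
    {y : EuclideanSpace ℝ (Fin n)} (hy : y ∈ (extChartAt (𝓡 n) x).target) :
    normalSpace (n := n) f ((extChartAt (𝓡 n) x).symm y) =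
      (LinearMap.range (fderiv ℝ (inChart (n := n) f x) y).toLinearMap)ᗮ := by
  ext ζ
  rw [mem_normalSpace_symm_iff hf hy, Submodule.mem_orthogonal]
  exact ⟨by rintro h _ ⟨X, rfl⟩; exact h X, fun h X => h _ ⟨X, rfl⟩⟩

end Chart

/-! ### Isometric immersions with flat normal bundle -/

section Immersion

variable {n N : ℕ} {M : Type*} [TopologicalSpace M] [ChartedSpace (EuclideanSpace ℝ (Fin n)) M]
  [Bundle.RiemannianBundle (fun x : M => TangentSpace (𝓡 n) x)]
  {f : M → EuclideanSpace ℝ (Fin N)}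

theorem IsIsometricImmersion.differential_injective (hf : IsIsometricImmersion (n := n) f) (x : M) :
    Function.Injective (differential (n := n) f x) := by
  refine (injective_iff_map_eq_zero _).2 fun X hX => ?_
  have h := hf.inner_mfderiv x X X
  rw [hX, inner_zero_left] at h
  exact inner_self_eq_zero.1 h.symm

variable [IsManifold (𝓡 n) ∞ M]

theorem IsIsometricImmersion.fderiv_inChart_injective (hf : IsIsometricImmersion (n := n) f)
    {x : M} {y : EuclideanSpace ℝ (Fin n)} (hy : y ∈ (extChartAt (𝓡 n) x).target) :
    Function.Injective (fderiv ℝ (inChart (n := n) f x) y) := by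
  obtain ⟨L, hL, h⟩ := exists_fderiv_inChart_eq hf.contMDiff hy
  intro v w hvw
  rw [h, h] at hvw
  exact hL.1 (hf.differential_injective _ hvw)

theorem IsIsometricImmersion.contDiffOn_normalPart (hf : IsIsometricImmersion (n := n) f) (x : M) :
    ContDiffOn ℝ ∞ (fun y => normalPart (n := n) f ((extChartAt (𝓡 n) x).symm y))
      (extChartAt (𝓡 n) x).target := by
  have hJ : ContDiffOn ℝ ∞ (fderiv ℝ (inChart (n := n) f x)) (extChartAt (𝓡 n) x).target :=
    (contDiffOn_inChart hf.contMDiff x).fderiv_of_isOpen (isOpen_extChartAt_target x) (by simp)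
  refine (contDiffOn_starProjection_orthogonal_range hJ
    fun y hy => hf.fderiv_inChart_injective hy).congr fun y hy => ?_
  simp only [normalPart, normalSpace_symm_eq hf.contMDiff hy]

/-- The Weingarten formula: the tangential derivative of the normal projection on a normal vector
`ζ` represents the negative of the shape operator of `ζ`. -/
theorem IsIsometricImmersion.inner_fderiv_normalPart (hf : IsIsometricImmersion (n := n) f) (x : M)
    {ζ : EuclideanSpace ℝ (Fin N)} (hζ : ζ ∈ normalSpace (n := n) f x)
    (v X : TangentSpace (𝓡 n) x) :
    inner ℝ (fderiv ℝ (fun y => normalPart (n := n) f ((extChartAt (𝓡 n) x).symm y))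
      (extChartAt (𝓡 n) x x) v ζ) (differential f x X) =
      -(inner ℝ (secondFundamentalForm f x v X) ζ : ℝ) := by
  set y₀ := extChartAt (𝓡 n) x x with hy₀
  have hmem : (extChartAt (𝓡 n) x).target ∈ nhds y₀ := extChartAt_target_mem_nhds x
  have hP := (((hf.contDiffOn_normalPart x).contDiffAt hmem).differentiableAt (by simp)).hasFDerivAt
  have hJ := ((((contDiffOn_inChart hf.contMDiff x).contDiffAt hmem).fderiv_right (m := 1)
    (by norm_cast)).differentiableAt (by simp)).hasFDerivAt
  have hx : (extChartAt (𝓡 n) x).symm y₀ = x := extChartAt_to_inv x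
  have h := inner_deriv_add_inner_deriv_eq_zero hP hJ (ζ := ζ) (X := X) (by
    filter_upwards [hmem] with y hy
    rw [real_inner_comm]
    exact (mem_normalSpace_symm_iff hf.contMDiff hy).1 (normalPart_mem f _ ζ) X) v
  rw [hx, normalPart_eq_self_iff.2 hζ, real_inner_comm, add_comm] at h
  rw [differential_apply_eq_fderiv hf.contMDiff, inner_secondFundamentalForm hζ, ← hy₀]
  rw [real_inner_comm]
  refine (eq_neg_of_add_eq_zero_right h).trans ?_
  rw [real_inner_comm]

/-- The derivative of the normal projection maps normal vectors to tangent vectors. -/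
theorem IsIsometricImmersion.exists_differential_eq_fderiv_normalPart
    (hf : IsIsometricImmersion (n := n) f) (x : M)
    {ζ : EuclideanSpace ℝ (Fin N)} (hζ : ζ ∈ normalSpace (n := n) f x)
    (v : EuclideanSpace ℝ (Fin n)) :
    ∃ X : TangentSpace (𝓡 n) x, differential f x X =
      fderiv ℝ (fun y => normalPart (n := n) f ((extChartAt (𝓡 n) x).symm y))
        (extChartAt (𝓡 n) x x) v ζ := by
  have hmem : (extChartAt (𝓡 n) x).target ∈ nhds (extChartAt (𝓡 n) x x) :=
    extChartAt_target_mem_nhds x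
  have hP := (((hf.contDiffOn_normalPart x).contDiffAt hmem).differentiableAt (by simp)).hasFDerivAt
  have h := apply_deriv_apply_eq_zero_of_idempotent hP (Filter.Eventually.of_forall fun z u =>
    normalPart_eq_self_iff.2 (normalPart_mem f _ u)) v (ζ := ζ)
    (by rw [extChartAt_to_inv]; exact normalPart_eq_self_iff.2 hζ)
  rw [extChartAt_to_inv, normalPart, Submodule.starProjection_apply_eq_zero_iff, normalSpace,
    Submodule.orthogonal_orthogonal] at h
  exact h

theorem IsIsometricImmersion.secondFundamentalForm_comm (hf : IsIsometricImmersion (n := n) f)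
    (x : M) (X Y : TangentSpace (𝓡 n) x) :
    secondFundamentalForm f x X Y = secondFundamentalForm f x Y X := by
  have h := (((contDiffOn_inChart hf.contMDiff x).contDiffAt
    (extChartAt_target_mem_nhds x)).isSymmSndFDerivAt
      (by simp only [minSmoothness_of_isRCLikeNormedField]; norm_cast)).eq X Y
  exact congrArg (normalPart (n := n) f x) h

/-- By the Ricci equation the shape operators of a submanifold with flat normal bundle commute, so
its second fundamental form is diagonalized by the principal normals; a normal vector orthogonal to
all of them has vanishing shape operator. -/
theorem IsIsometricImmersion.inner_secondFundamentalForm_eq_zero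
    (hf : IsIsometricImmersion (n := n) f) (hflat : HasFlatNormalBundle (n := n) f) (p : M)
    (ξ : normalSpace (n := n) f p) (hξ : ∀ η ∈ principalNormals f p, inner ℝ η ξ = (0 : ℝ))
    (X Y : TangentSpace (𝓡 n) p) :
    inner ℝ (secondFundamentalForm f p X Y) (ξ : EuclideanSpace ℝ (Fin N)) = (0 : ℝ) := by
  have : FiniteDimensional ℝ (TangentSpace (𝓡 n) p) :=
    inferInstanceAs (FiniteDimensional ℝ (EuclideanSpace ℝ (Fin n)))
  set P : EuclideanSpace ℝ (Fin n) → EuclideanSpace ℝ (Fin N) →L[ℝ] EuclideanSpace ℝ (Fin N) :=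
    fun y => normalPart (n := n) f ((extChartAt (𝓡 n) p).symm y) with hPdef
  set y₀ := extChartAt (𝓡 n) p p with hy₀
  have hmem : (extChartAt (𝓡 n) p).target ∈ nhds y₀ := extChartAt_target_mem_nhds p
  have hpy : (extChartAt (𝓡 n) p).symm y₀ = p := extChartAt_to_inv p
  have hP := (hf.contDiffOn_normalPart p).contDiffAt hmem
  choose S hS using fun (ζ : normalSpace (n := n) f p) (v : TangentSpace (𝓡 n) p) =>
    hf.exists_differential_eq_fderiv_normalPart p ζ.2 v
  have hinj := hf.differential_injective p
  let A : normalSpace (n := n) f p → TangentSpace (𝓡 n) p →ₗ[ℝ] TangentSpace (𝓡 n) p := fun ζ =>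
    { toFun := fun v => -S ζ v
      map_add' := fun v w => by
        rw [← neg_add, neg_inj]
        apply hinj
        rw [map_add, hS, hS, hS]
        exact congrArg (fun T => T ζ.1) (map_add (fderiv ℝ P y₀) v w)
      map_smul' := fun c v => by
        have h : S ζ (c • v) = c • S ζ v := by
          apply hinj
          rw [map_smul, hS, hS]
          exact congrArg (fun T => T ζ.1) (map_smul (fderiv ℝ P y₀) c v)
        exact (congrArg Neg.neg h).trans (smul_neg c (S ζ v)).symm }
  refine inner_eq_zero_of_orthogonal_principalNormals
    (fun X Y => (⟨secondFundamentalForm f p X Y, normalPart_mem f p _⟩ : normalSpace (n := n) f p))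
    (fun X Y => Subtype.ext (hf.secondFundamentalForm_comm p X Y)) A ?_ ?_ ξ ?_ X Y
  · intro ζ X Y
    change inner ℝ (-S ζ X) Y = (inner ℝ (secondFundamentalForm f p X Y) ζ.1 : ℝ)
    rw [inner_neg_left, ← hf.inner_mfderiv, hS, hf.inner_fderiv_normalPart p ζ.2, neg_neg]
  · intro ζ₀ ζ₁ X Y
    change inner ℝ (-S ζ₀ X) (-S ζ₁ Y) = (inner ℝ (-S ζ₀ Y) (-S ζ₁ X) : ℝ)
    rw [inner_neg_neg, inner_neg_neg, ← hf.inner_mfderiv, ← hf.inner_mfderiv, hS, hS, hS, hS]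
    refine inner_deriv_projection_comm (hP.of_le (by norm_cast))
      (Filter.Eventually.of_forall fun z => inner_normalPart_left f _) Y X ζ₀.1 ζ₁.1 ?_ ?_
    · rw [hpy]; exact normalPart_eq_self_iff.2 ζ₁.2
    · exact hflat p Y X (fun y => P y ζ₀.1)
        ((hf.contDiffOn_normalPart p).clm_apply contDiffOn_const) fun y _ => normalPart_mem f _ _
  · rintro η ⟨X, hX, h⟩
    exact hξ η ⟨X, hX, fun Y => congrArg Subtype.val (h Y)⟩

/-- A parallel normal field whose shape operators vanish is constant in the ambient space. -/
theorem IsIsometricImmersion.hasDerivWithinAt_zero_of_isParallelAlong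
    (hf : IsIsometricImmersion (n := n) f) {a b : ℝ} (hab : a < b) {γ : ℝ → M}
    {ξ : ℝ → EuclideanSpace ℝ (Fin N)} (hγ : ContMDiffOn 𝓘(ℝ, ℝ) (𝓡 n) ∞ γ (Set.Icc a b))
    (hξ : IsParallelAlong (n := n) f a b γ ξ)
    (hA : ∀ t ∈ Set.Icc a b, principalCurvatureSpace (n := n) f (γ t) (ξ t) 0 = ⊤)
    {t : ℝ} (ht : t ∈ Set.Icc a b) : HasDerivWithinAt ξ 0 (Set.Icc a b) t := by
  obtain ⟨hn, ξ', hξ', hpar⟩ := hξ t ht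
  suffices h : ξ' ∈ normalSpace (n := n) f (γ t) by
    rwa [← normalPart_eq_self_iff.2 h, hpar] at hξ'
  -- In the preferred chart at `γ t`, differentiate `⟨ξ, df X⟩ = 0` along the curve.
  set x := γ t with hx
  have hmem : (extChartAt (𝓡 n) x).target ∈ nhds (extChartAt (𝓡 n) x x) :=
    extChartAt_target_mem_nhds x
  have hJ := ((((contDiffOn_inChart hf.contMDiff x).contDiffAt hmem).fderiv_right (m := 1)
    (by norm_cast)).differentiableAt (by simp)).hasFDerivAt
  have hcd : DifferentiableWithinAt ℝ (fun s => extChartAt (𝓡 n) x (γ s)) (Set.Icc a b) t := by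
    have h1 : MDifferentiableAt (𝓡 n) 𝓘(ℝ, EuclideanSpace ℝ (Fin n)) (extChartAt (𝓡 n) x) (γ t) :=
      (contMDiffAt_extChartAt (n := ∞)).mdifferentiableAt (by simp)
    exact (h1.comp_mdifferentiableWithinAt t
      ((hγ t ht).mdifferentiableWithinAt (by simp))).differentiableWithinAt
  have hev : ∀ᶠ s in nhdsWithin t (Set.Icc a b), γ s ∈ (extChartAt (𝓡 n) x).source :=
    (hγ t ht).continuousWithinAt.preimage_mem_nhdsWithin (extChartAt_source_mem_nhds x)
  rw [mem_normalSpace_iff]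
  intro X
  have h1 := inner_derivWithin_add_inner_deriv_eq_zero (uniqueDiffOn_Icc hab t ht) ht hξ'
    hcd.hasDerivWithinAt hJ (X := X) (by
      filter_upwards [hev, self_mem_nhdsWithin] with s hs hs'
      have h2 := (hξ s hs').1
      rw [← (extChartAt (𝓡 n) x).left_inv hs] at h2
      rw [real_inner_comm]
      exact (mem_normalSpace_symm_iff hf.contMDiff ((extChartAt (𝓡 n) x).map_source hs)).1 h2 X)
  have h2 : derivWithin (fun s => extChartAt (𝓡 n) x (γ s)) (Set.Icc a b) t ∈
      principalCurvatureSpace (n := n) f x (ξ t) 0 := by rw [hA t ht]; trivial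
  have h3 := (inner_secondFundamentalForm hn _ X).symm.trans ((h2 X).trans (zero_mul _))
  rw [differential_apply_eq_fderiv hf.contMDiff, real_inner_comm]
  rw [real_inner_comm] at h3
  exact (add_eq_right.1 (h1.trans h3.symm) :)

end Immersion

/-! ### Propagation of the contact with a hyperplane -/

section Transport

variable {n N : ℕ} {M : Type*} [TopologicalSpace M] [ChartedSpace (EuclideanSpace ℝ (Fin n)) M]
  [IsManifold (𝓡 n) ∞ M] [Bundle.RiemannianBundle (fun x : M => TangentSpace (𝓡 n) x)]
  {f : M → EuclideanSpace ℝ (Fin N)}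

/-- The points at which `f` has second order contact with the hyperplane `⟨ξ, ·⟩ = c`: `ξ` is normal,
its shape operator vanishes, and `⟨ξ, f⟩ = c`. -/
def hyperplaneContactSet (f : M → EuclideanSpace ℝ (Fin N)) (ξ : EuclideanSpace ℝ (Fin N)) (c : ℝ) :
    Set M :=
  {x | ξ ∈ normalSpace (n := n) f x ∧ principalCurvatureSpace (n := n) f x ξ 0 = ⊤ ∧
    inner ℝ (f x) ξ = c}

/-- Along a chart segment on which the normal projection varies slowly, second order contact with a
hyperplane propagates: the parallel field starting at `ξ` has vanishing shape operators since its
principal curvatures are constant, hence it is constant, and so is `⟨f, ξ⟩`. -/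
theorem IsIsoparametric.mem_hyperplaneContactSet_of_segment (hf : IsIsoparametric (n := n) f)
    {x : M} {y z : EuclideanSpace ℝ (Fin n)}
    (hseg : ∀ t ∈ Set.Icc (0 : ℝ) 1, y + t • (z - y) ∈ (extChartAt (𝓡 n) x).target)
    (hsmall : ∀ t ∈ Set.Icc (0 : ℝ) 1,
      ‖fderiv ℝ (fun y => normalPart (n := n) f ((extChartAt (𝓡 n) x).symm y))
        (y + t • (z - y)) (z - y)‖ ≤ 1 / 2)
    {ξ : EuclideanSpace ℝ (Fin N)} {c : ℝ}
    (hy : (extChartAt (𝓡 n) x).symm y ∈ hyperplaneContactSet (n := n) f ξ c) :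
    (extChartAt (𝓡 n) x).symm z ∈ hyperplaneContactSet (n := n) f ξ c := by
  obtain ⟨hnor, hpcs, hc⟩ := hy
  have hfi := hf.isometricImmersion
  set σ : ℝ → EuclideanSpace ℝ (Fin n) := fun t => y + t • (z - y) with hσ
  have hσ0 : σ 0 = y := by simp [hσ]
  have hσ1 : σ 1 = z := by simp [hσ]
  have hσd : ∀ t, HasDerivAt σ (z - y) t := fun t => by
    have h := ((hasDerivAt_id t).smul_const (z - y)).const_add y
    rw [one_smul] at h
    exact h
  have hσc : ContDiff ℝ ∞ σ := contDiff_const.add (contDiff_id.smul contDiff_const)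
  have hopen : IsOpen (extChartAt (𝓡 n) x).target := isOpen_extChartAt_target x
  set P : EuclideanSpace ℝ (Fin n) → EuclideanSpace ℝ (Fin N) →L[ℝ] EuclideanSpace ℝ (Fin N) :=
    fun y => normalPart (n := n) f ((extChartAt (𝓡 n) x).symm y) with hP
  have hPc : ContDiffOn ℝ ∞ P (extChartAt (𝓡 n) x).target := hfi.contDiffOn_normalPart x
  have hPd : ∀ t ∈ Set.Icc (0 : ℝ) 1, HasFDerivAt P (fderiv ℝ P (σ t)) (σ t) := fun t ht =>
    ((hPc.contDiffAt (hopen.mem_nhds (hseg t ht))).differentiableAt (by simp)).hasFDerivAt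
  have hB : ContinuousOn (fun t => fderiv ℝ P (σ t) (z - y)) (Set.Icc 0 1) :=
    ((hPc.continuousOn_fderiv_of_isOpen hopen (by simp)).comp hσc.continuous.continuousOn
      hseg).clm_apply continuousOn_const
  obtain ⟨ζ, hζ0, hζ⟩ := exists_parallel_section (P := fun t => P (σ t))
    (B := fun t => fderiv ℝ P (σ t) (z - y)) (ξ₀ := ξ)
    (fun t ht => ((hPd t ht).comp_hasDerivAt t (hσd t)).hasDerivWithinAt)
    (fun t _ u => normalPart_eq_self_iff.2 (normalPart_mem f _ u))
    (fun t _ => Submodule.starProjection_norm_le _) hB hsmall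
    (by rw [hσ0]; exact normalPart_eq_self_iff.2 hnor)
  set γ : ℝ → M := fun t => (extChartAt (𝓡 n) x).symm (σ t) with hγdef
  have hγ : ContMDiffOn 𝓘(ℝ, ℝ) (𝓡 n) ∞ γ (Set.Icc 0 1) :=
    (contMDiffOn_extChartAt_symm x).comp hσc.contMDiff.contMDiffOn hseg
  have hpar : IsParallelAlong (n := n) f 0 1 γ ζ := fun t ht =>
    ⟨normalPart_eq_self_iff.1 (hζ t ht).1, (hζ t ht).2⟩
  have hγ0 : γ 0 = (extChartAt (𝓡 n) x).symm y := by simp only [hγdef, hσ0]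
  have h0 : (0 : ℝ) ∈ Set.Icc (0 : ℝ) 1 := Set.left_mem_Icc.2 zero_le_one
  have h1 : (1 : ℝ) ∈ Set.Icc (0 : ℝ) 1 := Set.right_mem_Icc.2 zero_le_one
  have hA : ∀ t ∈ Set.Icc (0 : ℝ) 1, principalCurvatureSpace (n := n) f (γ t) (ζ t) 0 = ⊤ := by
    intro t ht
    have hfin : ∀ x : M, FiniteDimensional ℝ (TangentSpace (𝓡 n) x) := fun x =>
      inferInstanceAs (FiniteDimensional ℝ (EuclideanSpace ℝ (Fin n)))
    have hpcs0 : principalCurvatureSpace (n := n) f (γ 0) ξ 0 = ⊤ := by rw [hγ0]; exact hpcs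
    -- The principal curvature `0` keeps its multiplicity `n`.
    apply Submodule.eq_top_of_finrank_eq
    rw [hf.constant 0 1 γ ζ hγ hpar t ht 0 h0 0, hζ0, hpcs0, finrank_top]
    rfl
  have hζc : ∀ t ∈ Set.Icc (0 : ℝ) 1, ζ t = ξ := by
    have hd := fun t (ht : t ∈ Set.Icc (0 : ℝ) 1) =>
      hfi.hasDerivWithinAt_zero_of_isParallelAlong zero_lt_one hγ hpar hA ht
    intro t ht
    rw [← hζ0]
    exact constant_of_derivWithin_zero (fun t ht => (hd t ht).differentiableWithinAt)
      (fun t ht => (hd t ⟨ht.1, ht.2.le⟩).derivWithin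
        (uniqueDiffOn_Icc zero_lt_one t ⟨ht.1, ht.2.le⟩)) t ht
  have hγ1 : γ 1 = (extChartAt (𝓡 n) x).symm z := by simp only [hγdef, hσ1]
  rw [← hγ1]
  refine ⟨?_, ?_, ?_⟩
  · rw [← hζc 1 h1]; exact (hpar 1 h1).1
  · have := hA 1 h1
    rwa [hζc 1 h1] at this
  · have hd : ∀ t ∈ Set.Icc (0 : ℝ) 1,
        HasDerivWithinAt (fun t => (inner ℝ (f (γ t)) ξ : ℝ)) 0 (Set.Icc 0 1) t := by
      intro t ht
      have hF := (((contDiffOn_inChart hfi.contMDiff x).contDiffAt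
        (hopen.mem_nhds (hseg t ht))).differentiableAt (by simp)).hasFDerivAt
      have h2 := ((hF.comp_hasDerivAt t (hσd t)).inner ℝ (hasDerivAt_const t ξ)).hasDerivWithinAt
        (s := Set.Icc 0 1)
      have h3 := (mem_normalSpace_symm_iff hfi.contMDiff (hseg t ht)).1 (hpar t ht).1 (z - y)
      rw [hζc t ht] at h3
      rw [inner_zero_right, zero_add] at h2
      exact h3 ▸ h2
    rw [← hc, ← hγ0]
    exact constant_of_derivWithin_zero (fun t ht => (hd t ht).differentiableWithinAt)
      (fun t ht => (hd t ⟨ht.1, ht.2.le⟩).derivWithin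
        (uniqueDiffOn_Icc zero_lt_one t ⟨ht.1, ht.2.le⟩)) 1 h1

/-- Locally, second order contact with a given hyperplane holds at all points or at none. -/
theorem IsIsoparametric.exists_nhds_mem_hyperplaneContactSet (hf : IsIsoparametric (n := n) f)
    (x : M) : ∃ U ∈ nhds x, ∀ ξ c, ∀ y ∈ U, ∀ z ∈ U,
      y ∈ hyperplaneContactSet (n := n) f ξ c → z ∈ hyperplaneContactSet (n := n) f ξ c := by
  have hopen : IsOpen (extChartAt (𝓡 n) x).target := isOpen_extChartAt_target x
  set P : EuclideanSpace ℝ (Fin n) → EuclideanSpace ℝ (Fin N) →L[ℝ] EuclideanSpace ℝ (Fin N) :=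
    fun y => normalPart (n := n) f ((extChartAt (𝓡 n) x).symm y) with hP
  set y₀ := extChartAt (𝓡 n) x x with hy₀
  have hmem : (extChartAt (𝓡 n) x).target ∈ nhds y₀ := extChartAt_target_mem_nhds x
  have hcont : ContinuousAt (fderiv ℝ P) y₀ :=
    ((hf.isometricImmersion.contDiffOn_normalPart x).continuousOn_fderiv_of_isOpen hopen
      (by simp)).continuousAt hmem
  obtain ⟨C, hCpos, hC⟩ := exists_eventually_norm_fderiv_apply_le hcont
  obtain ⟨r, hr, hball⟩ := Metric.mem_nhds_iff.1 (Filter.inter_mem hmem hC)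
  -- On the ball of radius `ρ` the derivative of `P` along a segment is at most `1 / 2`, as two
  -- points of a ball of radius `1 / (4 C)` are at distance at most `1 / (2 C)`.
  set ρ : ℝ := min r (1 / (4 * C)) with hρ
  have hρpos : 0 < ρ := lt_min hr (by positivity)
  refine ⟨(extChartAt (𝓡 n) x).source ∩ extChartAt (𝓡 n) x ⁻¹' Metric.ball y₀ ρ,
    Filter.inter_mem (extChartAt_source_mem_nhds x)
      ((continuousAt_extChartAt x).preimage_mem_nhds (Metric.ball_mem_nhds _ hρpos)), ?_⟩
  rintro ξ c y ⟨hys, hyb⟩ z ⟨hzs, hzb⟩ hy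
  have hseg : ∀ t ∈ Set.Icc (0 : ℝ) 1, extChartAt (𝓡 n) x y +
      t • (extChartAt (𝓡 n) x z - extChartAt (𝓡 n) x y) ∈ Metric.ball y₀ r := fun t ht =>
    Metric.ball_subset_ball (min_le_left _ _)
      ((convex_ball y₀ ρ).add_smul_sub_mem hyb hzb ht)
  rw [← (extChartAt (𝓡 n) x).left_inv hzs]
  rw [← (extChartAt (𝓡 n) x).left_inv hys] at hy
  refine hf.mem_hyperplaneContactSet_of_segment (fun t ht => (hball (hseg t ht)).1) (fun t ht => ?_)
    hy
  have hdist : ‖extChartAt (𝓡 n) x z - extChartAt (𝓡 n) x y‖ ≤ 2 * (1 / (4 * C)) := by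
    rw [← dist_eq_norm]
    have h1 : dist (extChartAt (𝓡 n) x z) y₀ < ρ := hzb
    have h2 : dist (extChartAt (𝓡 n) x y) y₀ < ρ := hyb
    have h3 := dist_triangle_right (extChartAt (𝓡 n) x z) (extChartAt (𝓡 n) x y) y₀
    have h4 : ρ ≤ 1 / (4 * C) := min_le_right _ _
    linarith
  calc _ ≤ C * ‖extChartAt (𝓡 n) x z - extChartAt (𝓡 n) x y‖ := (hball (hseg t ht)).2 _
    _ ≤ C * (2 * (1 / (4 * C))) := by gcongr
    _ = 1 / 2 := by field_simp; norm_num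

theorem IsIsoparametric.hyperplaneContactSet_eq_univ [PreconnectedSpace M]
    (hf : IsIsoparametric (n := n) f) {p : M} {ξ : EuclideanSpace ℝ (Fin N)} {c : ℝ}
    (hp : p ∈ hyperplaneContactSet (n := n) f ξ c) :
    hyperplaneContactSet (n := n) f ξ c = Set.univ := by
  have hclopen : IsClopen (hyperplaneContactSet (n := n) f ξ c) := by
    constructor
    · refine isOpen_compl_iff.1 (isOpen_iff_mem_nhds.2 fun x hx => ?_)
      obtain ⟨U, hU, h⟩ := hf.exists_nhds_mem_hyperplaneContactSet x
      filter_upwards [hU] with y hy hy' using hx (h ξ c y hy x (mem_of_mem_nhds hU) hy')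
    · refine isOpen_iff_mem_nhds.2 fun x hx => ?_
      obtain ⟨U, hU, h⟩ := hf.exists_nhds_mem_hyperplaneContactSet x
      filter_upwards [hU] with y hy using h ξ c x (mem_of_mem_nhds hU) y hy hx
  exact hclopen.eq_univ ⟨p, hp⟩

end Transport

end Isoparametric

theorem mainTheorem11 {n N : ℕ} {M : Type*} [TopologicalSpace M] [T2Space M]
    [CompactSpace M] [ConnectedSpace M]
    [ChartedSpace (EuclideanSpace ℝ (Fin n)) M] [IsManifold (𝓡 n) ∞ M]
    [Bundle.RiemannianBundle (fun x : M => TangentSpace (𝓡 n) x)]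
    [IsContMDiffRiemannianBundle (𝓡 n) ∞ (EuclideanSpace ℝ (Fin n))
      (fun x : M => TangentSpace (𝓡 n) x)]
    (f : M → EuclideanSpace ℝ (Fin N)) (hf : Isoparametric.IsIsoparametric (n := n) f) (p : M)
    (ξ : Isoparametric.normalSpace (n := n) f p) (hξ : ξ ≠ 0)
    (H : AffineSubspace ℝ (Isoparametric.normalSpace (n := n) f p))
    (hH_nonempty : (H : Set (Isoparametric.normalSpace (n := n) f p)).Nonempty)
    (hH_direction : H.direction = (Submodule.span ℝ {ξ})ᗮ)
    (hH_not_focal : ∀ η ∈ Isoparametric.principalNormals f p,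
      H ≠ Isoparametric.focalHyperplane η)
    (hH_invariant : ∀ g ∈ Isoparametric.weylGroup f p,
      (g : Isoparametric.normalSpace (n := n) f p → Isoparametric.normalSpace (n := n) f p) ''
        (H : Set (Isoparametric.normalSpace (n := n) f p)) = H) :
    Set.range f ⊆ AffineSubspace.mk' (f p)
      (Submodule.span ℝ {(ξ : EuclideanSpace ℝ (Fin N))})ᗮ := by
  have horth : ∀ η ∈ Isoparametric.principalNormals f p, inner ℝ η ξ = (0 : ℝ) := by
    intro η hη
    by_cases h0 : η = 0
    · rw [h0, inner_zero_left]
    exact Isoparametric.inner_eq_zero_of_image_focalReflection_eq h0 hξ hH_nonempty hH_direction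
      (hH_not_focal η hη) (hH_invariant _ (Subgroup.subset_closure ⟨η, hη, h0, rfl⟩))
  have hp : p ∈ Isoparametric.hyperplaneContactSet (n := n) f ξ (inner ℝ (f p) ξ.1) := by
    refine ⟨ξ.2, ?_, rfl⟩
    rw [Submodule.eq_top_iff']
    intro X Y
    rw [hf.isometricImmersion.inner_secondFundamentalForm_eq_zero hf.flat p ξ horth, zero_mul]
  rintro _ ⟨x, rfl⟩
  have hx : x ∈ Isoparametric.hyperplaneContactSet (n := n) f ξ (inner ℝ (f p) ξ.1) := by
    rw [hf.hyperplaneContactSet_eq_univ hp]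
    trivial
  rw [SetLike.mem_coe, AffineSubspace.mem_mk', vsub_eq_sub,
    Submodule.mem_orthogonal_singleton_iff_inner_left, inner_sub_left, hx.2.2, sub_self]
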